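/- **Lemma 2.8.** Let $T$ be a first-order theory and let $k \ge 2$ be an integer. Then $T$ has $\mathrm{SOP}_2$ if and only if $T$ has $k$-$\mathrm{DCTP}_1$. Here, with $x, y$ finite tuples of variables and with all tuples of parameters taken in a sufficiently saturated model of $T$ (if $T$ is not complete: in some model of $T$), and a set of formulas with parameters in a model called consistent if each of its finite subsets is realized in that model: * $T$ has $\mathrm{SOP}_2$ if there are a formula $\varphi(x,y)$ and tuples $(b_\eta)_{\eta \in 2^{<\omega}}$ such that $\{\varphi(x, b_{\sigma \restriction n}) : n \in \omega\}$ is consistent for every $\sigma \in 2^{\omega}$, while $\{\varphi(x, b_{\eta_1}), \varphi(x, b_{\eta_2})\}$ is inconsistent for all incomparable $\eta_1, \eta_2 \in 2^{<\omega}$. * For $\eta, \nu \in \omega^{<\omega}$, write $\eta \lhd \nu$ if $\eta$ is a proper initial segment of $\nu$, $\eta \wedge \nu$ for the longest common initial segment, and $<_{\mathrm{lex}}$ for the lexicographic order. A list $\eta_1, \dots, \eta_n \in \omega^{<\omega}$ is a *descending comb* if it is an antichain for $\lhd$, $\eta_1 <_{\mathrm{lex}} \dots <_{\mathrm{lex}}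 \eta_n$, and $\eta_1 \wedge \dots \wedge \eta_{j+1} \lhd \eta_1 \wedge \dots \wedge \eta_j$ for all $1 \le j < n$. * $T$ has $k$-$\mathrm{DCTP}_1$ if there are a formula $\varphi(x,y)$ and tuples $(b_\eta)_{\eta \in \omega^{<\omega}}$ such that $\{\varphi(x, b_{\sigma \restriction n}) : n \in \omega\}$ is consistent for every $\sigma \in \omega^{\omega}$, while $\{\varphi(x, b_{\eta_1}), \dots, \varphi(x, b_{\eta_k})\}$ is inconsistent for every descending comb $\eta_1, \dots, \eta_k \in \omega^{<\omega}$. -/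

import Mathlib

/-! Nodes of the tree `A^{<ω}` are lists over `A`: the node `⟨a₀, …, aₙ₋₁⟩` is `[a₀, …, aₙ₋₁]`, the
tree order `⊴` is the prefix order `<+:`, and the lexicographic order on `ω^{<ω}` is `<` on
`List ℕ`. -/

universe u v w

namespace TreeIndex

/-- The restriction `σ ↾ n ∈ A^{<ω}` of a branch `σ ∈ A^ω`. -/
def restrict {A : Type} (σ : ℕ → A) (n : ℕ) : List A :=
  (List.range n).map σ

/-- Two nodes are incomparable: neither is an initial segment of the other. -/
def Incomparable {A : Type} (η ν : List A) : Prop :=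
  ¬ η <+: ν ∧ ¬ ν <+: η

/-- The strict tree order `η ◁ ν`. -/
def StrictlyBelow {A : Type} (η ν : List A) : Prop :=
  η <+: ν ∧ η ≠ ν

/-- The meet `η ∧ ν`: the longest common initial segment. -/
def meet {A : Type} [DecidableEq A] : List A → List A → List A
  | a :: η, b :: ν => if a = b then a :: meet η ν else []
  | _, _ => []

/-- The meet `η₁ ∧ … ∧ ηₙ` of a nonempty list of nodes (the root, by convention, for the empty
list, which is never used below). -/
def meetAll {A : Type} [DecidableEq A] : List (List A) → List A
  | [] => []
  | [η] => η
  | η :: ν :: s => meet η (meetAll (ν :: s))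

/-- `η₁, …, ηₙ ∈ ω^{<ω}` is a descending comb: it is an antichain, `η₁ <_lex … <_lex ηₙ`, and
`η₁ ∧ … ∧ η_{j+1} ◁ η₁ ∧ … ∧ η_j` for `1 ≤ j < n`. -/
def IsDescendingComb (s : List (List ℕ)) : Prop :=
  s.Pairwise Incomparable ∧
  s.Pairwise (· < ·) ∧
  ∀ j : ℕ, 1 ≤ j → j < s.length →
    StrictlyBelow (meetAll (s.take (j + 1))) (meetAll (s.take j))

end TreeIndex

namespace FirstOrder.Language

/-- The set of instances `{φ(x, b) : b ∈ S}` of `φ(x, y)` with parameters in `M` is consistent (with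
the elementary diagram of `M`): every finite subset of it is realized in `M`. When `M` is
`ℵ₁`-saturated and `S` is countable, this says that all of it is realized in `M`. -/
def ConsistentInstances {L : Language.{u, v}} {M : Type w} [L.Structure M] {m n : ℕ}
    (φ : L.Formula (Fin m ⊕ Fin n)) (S : Set (Fin n → M)) : Prop :=
  ∀ F : Set (Fin n → M), F ⊆ S → F.Finite →
    ∃ a : Fin m → M, ∀ b ∈ F, φ.Realize (Sum.elim a b)

namespace Theory

/-- `T` has `SOP₂`: in some model of `T` (for complete `T`: in the monster model) there are a formula
`φ(x, y)` and tuples `(b_η)`, `η ∈ 2^{<ω}`, such that `φ` is consistent along every branch, while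
`{φ(x, b_η), φ(x, b_ν)}` is inconsistent for all incomparable `η, ν`. -/
def HasSOP2 {L : Language.{u, v}} (T : L.Theory) : Prop :=
  ∃ (M : ModelType.{u, v, max u v} T) (m n : ℕ) (φ : L.Formula (Fin m ⊕ Fin n))
    (b : List Bool → (Fin n → M)),
    (∀ σ : ℕ → Bool,
      ConsistentInstances φ (Set.range fun i : ℕ => b (TreeIndex.restrict σ i))) ∧
    (∀ η ν : List Bool, TreeIndex.Incomparable η ν → ¬ ConsistentInstances φ {b η, b ν})

/-- `T` has `k-DCTP₁`: in some model of `T` (for complete `T`: in the monster model) there are a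
formula `φ(x, y)` and tuples `(b_η)`, `η ∈ ω^{<ω}`, such that `φ` is consistent along every branch,
while `{φ(x, b_{η₁}), …, φ(x, b_{ηₖ})}` is inconsistent for every descending comb `η₁, …, ηₖ`. -/
def HasDCTP1 {L : Language.{u, v}} (T : L.Theory) (k : ℕ) : Prop :=
  ∃ (M : ModelType.{u, v, max u v} T) (m n : ℕ) (φ : L.Formula (Fin m ⊕ Fin n))
    (b : List ℕ → (Fin n → M)),
    (∀ σ : ℕ → ℕ,
      ConsistentInstances φ (Set.range fun i : ℕ => b (TreeIndex.restrict σ i))) ∧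
    (∀ s : List (List ℕ), s.length = k → TreeIndex.IsDescendingComb s →
      ¬ ConsistentInstances φ {c | ∃ η ∈ s, c = b η})

end Theory

end FirstOrder.Language

/-! From `SOP₂` to `k-DCTP₁`: embed `ω^{<ω}` in `2^{<ω}` by a prefix code. Branches land inside
branches, and any two nodes of a comb stay incomparable.

Conversely, call a finite set of nodes of `ω^{<ω}` good if its instances are jointly satisfiable.
Draw words generically from an idempotent ultrafilter (`Generically.blocks`), and let `P n d` say
that generically the comb with `n` teeth of `d + 1` nodes each is good. `P 1 d` always holds, since
one tooth is a chain; `P k 0` fails, since the tips form a descending comb. So for some `n`, `P (n +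
1) d` holds for every `d`, but `P (n + 2) d` fails for some `d`.

Fix these `n` and `d`. Inside a long generic sequence grow a binary tree of combs with `n + 1`
teeth, the teeth lengthening along branches, and keep at each node only the last `d + 1` nodes of
every tooth (`exists_tree_of_combs`). Along a branch everything lies in one comb with `n + 1` long
teeth, which is good. At incomparable nodes the top tooth forks, which gives a comb with `n + 2`
teeth, which is bad. Each set has `N = (n + 1)(d + 1)` elements, so a conjunction of `N` copies of
`φ` has trees of every finite height, and an ultrapower yields an infinite one. -/

namespace TreeIndex

open Filter

/-! ### Idempotent ultrafilters and generic sequences of words -/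

/-- A nonprincipal idempotent ultrafilter on the free monoid of words over `ℕ`, concentrating on
words with arbitrarily large first letter. -/
theorem exists_idempotent_ultrafilter_words :
    ∃ p : Ultrafilter (List ℕ),
      (∀ Q : List ℕ → Prop, (∀ᶠ w in p, Q w) → ∀ᶠ u in p, ∀ᶠ v in p, Q (u ++ v)) ∧
      ∀ N : ℕ, ∀ᶠ w in p, ∃ a t, w = a :: t ∧ N < a := by
  let _ : Semigroup (Ultrafilter (FreeMonoid ℕ)) := Ultrafilter.semigroup
  let B : ℕ → Set (FreeMonoid ℕ) := fun N => {w : List ℕ | ∃ a t, w = a :: t ∧ N < a}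
  let S : Set (Ultrafilter (FreeMonoid ℕ)) := ⋂ N, {U | B N ∈ U}
  have hclosed : IsClosed S := isClosed_iInter fun N => ultrafilter_isClosed_basic _
  have hne : S.Nonempty := by
    refine ⟨(hyperfilter ℕ).map (fun a => ([a] : List ℕ)), Set.mem_iInter.2 fun N => ?_⟩
    have h : ∀ᶠ a in (hyperfilter ℕ : Filter ℕ), N < a :=
      Nat.hyperfilter_le_atTop (eventually_gt_atTop N)
    exact Filter.mem_map.2 (h.mono fun a ha => ⟨a, [], rfl, ha⟩)
  have hmul : ∀ᵉ (x ∈ S) (y ∈ S), x * y ∈ S := by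
    intro x hx y _
    refine Set.mem_iInter.2 fun N => ?_
    have hxN : ∀ᶠ w in (x : Filter (FreeMonoid ℕ)), w ∈ B N := Set.mem_iInter.1 hx N
    -- The first letter of `u ++ v` is that of `u`, so only the left factor matters.
    refine (Ultrafilter.eventually_mul x y (· ∈ B N)).2 (hxN.mono fun u hu => ?_)
    obtain ⟨a, (t : List ℕ), rfl, ha⟩ := hu
    exact Eventually.of_forall fun (v : List ℕ) => ⟨a, t ++ v, rfl, ha⟩
  obtain ⟨p, hpS, hp⟩ := exists_idempotent_in_compact_subsemigroup
    (fun r : Ultrafilter (FreeMonoid ℕ) => Ultrafilter.continuous_mul_left r) S hne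
    hclosed.isCompact hmul
  refine ⟨p, fun Q hQ => ?_, fun N => Set.mem_iInter.1 hpS N⟩
  have h : ∀ᶠ w in ((p * p : Ultrafilter (FreeMonoid ℕ)) : Filter (FreeMonoid ℕ)), Q w := by
    rw [hp]; exact hQ
  exact (Ultrafilter.eventually_mul p p Q).1 h

/-- The iterated ultrafilter quantifier `∀ᵖ w₁, …, ∀ᵖ wₘ, Q [w₁, …, wₘ]`. -/
def Generically {A : Type} (p : Ultrafilter A) : ℕ → (List A → Prop) → Prop
  | 0, Q => Q []
  | m + 1, Q => ∀ᶠ w in p, Generically p m fun ws => Q (w :: ws)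

namespace Generically

variable {A : Type} {p : Ultrafilter A}

theorem mono {m : ℕ} {Q R : List A → Prop} (h : Generically p m Q)
    (hQR : ∀ ws : List A, ws.length = m → Q ws → R ws) : Generically p m R := by
  induction m generalizing Q R with
  | zero => exact hQR [] rfl h
  | succ m ih =>
    exact Eventually.mono h fun w hw => ih hw fun ws hws => hQR (w :: ws) (by simp [hws])

theorem of_forall {m : ℕ} {Q : List A → Prop} (h : ∀ ws : List A, ws.length = m → Q ws) :
    Generically p m Q := by
  induction m generalizing Q with
  | zero => exact h [] rfl
  | succ m ih => exact Eventually.of_forall fun w => ih fun ws hws => h (w :: ws) (by simp [hws])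

theorem and {m : ℕ} {Q R : List A → Prop} (hQ : Generically p m Q) (hR : Generically p m R) :
    Generically p m fun ws => Q ws ∧ R ws := by
  induction m generalizing Q R with
  | zero => exact ⟨hQ, hR⟩
  | succ m ih =>
    have hQ' : ∀ᶠ w in p, Generically p m fun ws => Q (w :: ws) := hQ
    have hR' : ∀ᶠ w in p, Generically p m fun ws => R (w :: ws) := hR
    exact (hQ'.and hR').mono fun w hw => ih hw.1 hw.2

theorem not {m : ℕ} {Q : List A → Prop} (h : ¬ Generically p m Q) :
    Generically p m fun ws => ¬ Q ws := by
  induction m generalizing Q with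
  | zero => exact h
  | succ m ih =>
    have h' : ∀ᶠ w in p, ¬ Generically p m fun ws => Q (w :: ws) :=
      Ultrafilter.eventually_not.2 h
    exact h'.mono fun w hw => ih hw

theorem exists_list {m : ℕ} {Q : List A → Prop} (h : Generically p m Q) :
    ∃ ws : List A, ws.length = m ∧ Q ws := by
  induction m generalizing Q with
  | zero => exact ⟨[], rfl, h⟩
  | succ m ih =>
    obtain ⟨w, hw⟩ := Eventually.exists h
    obtain ⟨ws, hws, hQ⟩ := ih hw
    exact ⟨w :: ws, by simp [hws], hQ⟩

/-- A finite form of the Milliken–Taylor theorem: what holds generically for an idempotent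
ultrafilter holds for all block sequences of a generic sequence. -/
theorem blocks {B : Type} {p : Ultrafilter (List B)}
    (hp : ∀ Q : List B → Prop, (∀ᶠ w in p, Q w) → ∀ᶠ u in p, ∀ᶠ v in p, Q (u ++ v))
    {m : ℕ} {Q : List (List B) → Prop} (h : Generically p m Q) (M : ℕ) :
    Generically p M fun ws => ∀ L : List (List (List B)), L.flatten.Sublist ws → [] ∉ L →
      L.length = m → Q (L.map List.flatten) := by
  induction M generalizing m Q with
  | zero =>
    intro L hL hne hlen
    cases L with
    | nil =>
      subst hlen
      exact h
    | cons X L =>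
      have hX : X = [] := by
        have := List.sublist_nil.1 hL
        simp at this
        exact this.1
      exact absurd (by simp [hX]) hne
  | succ M ih =>
    cases m with
    | zero =>
      refine of_forall fun ws _ L _ _ hlen => ?_
      rw [List.length_eq_zero_iff.1 hlen]
      exact h
    | succ m =>
      have h1 : ∀ᶠ w in p, Generically p m fun ws => Q (w :: ws) := h
      -- Idempotence makes `w` good both as a complete first entry and as the beginning of a longer
      -- one.
      refine (h1.and (hp _ h1)).mono fun w hw => ?_
      have hglue : Generically p (m + 1) fun ws =>
          ∀ v vs, ws = v :: vs → Q ((w ++ v) :: vs) :=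
        hw.2.mono fun v hv => hv.mono fun ws _ hQ v' vs' e => by
          obtain ⟨rfl, rfl⟩ := List.cons.inj e
          exact hQ
      -- Three cases for the new word `w`: unused, a block by itself, or joined to the rest of the
      -- first block.
      refine ((ih h).and ((ih hw.1).and (ih hglue))).mono fun ws _ hws L hL hne hlen => ?_
      obtain ⟨hskip, hsingle, hjoin⟩ := hws
      cases L with
      | nil => simp at hlen
      | cons X L =>
        cases X with
        | nil => simp at hne
        | cons x t =>
          have hneL : [] ∉ L := fun hmem => hne (List.mem_cons_of_mem _ hmem)
          have hlenL : L.length = m := by simpa using hlen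
          rw [List.flatten_cons, List.cons_append] at hL
          rcases List.sublist_cons_iff.1 hL with hL | ⟨r, hr, hL⟩
          · exact hskip _ (by simpa using hL) hne hlen
          · obtain ⟨rfl, rfl⟩ := List.cons.inj hr
            cases t with
            | nil => simpa using hsingle L (by simpa using hL) hneL hlenL
            | cons y t =>
              have := hjoin ((y :: t) :: L) (by simpa using hL) (by simp [hneL]) (by simp [hlenL])
                (y :: t).flatten (L.map List.flatten) rfl
              simpa using this

end Generically

/-! ### Combs of words and their nodes -/

/-! A comb shape `[(x₁, T₁), …, (xₙ, Tₙ)]` has the spine `x₁ … xₙ` and the tooth `Tᵢ` attached to the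
spine after `xᵢ`. -/

/-- The entries of a comb shape, the spine first and then the teeth from the top down. -/
def combWords {A : Type} : List (A × List A) → List A
  | [] => []
  | (x, T) :: C => x :: (combWords C ++ T)

/-- The nodes `s ⌢ y₁, s ⌢ y₁ ⌢ y₂, …` of a tooth attached to `s`. -/
def toothNodes {B : Type} (s : List B) : List (List B) → List (List B)
  | [] => []
  | y :: T => (s ++ y) :: toothNodes (s ++ y) T

/-- The nodes on the teeth of a comb attached to `s`. -/
def combNodes {B : Type} (s : List B) : List (List B × List (List B)) → List (List B)
  | [] => []
  | (x, T) :: C => combNodes (s ++ x) C ++ toothNodes (s ++ x) T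

/-- Apply a function to all entries of a comb shape. -/
def combMap {A B : Type} (f : A → B) (C : List (A × List A)) : List (B × List B) :=
  C.map (Prod.map f (List.map f))

theorem combWords_combMap {A B : Type} (f : A → B) (C : List (A × List A)) :
    combWords (combMap f C) = (combWords C).map f := by
  induction C with
  | nil => rfl
  | cons c C ih =>
    simp only [combMap] at ih
    simp [combMap, combWords, ih]

theorem length_combWords {A : Type} {C : List (A × List A)} {d : ℕ}
    (h : ∀ c ∈ C, c.2.length = d) : (combWords C).length = C.length * (d + 1) := by
  induction C with
  | nil => simp [combWords]
  | cons c C ih =>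
    have h1 := ih fun c' hc' => h c' (List.mem_cons_of_mem _ hc')
    have h2 := h c List.mem_cons_self
    simp only [combWords, List.length_cons, List.length_append, h1, h2]
    ring

theorem combWords_injective {A : Type} {d : ℕ} {C C' : List (A × List A)}
    (hlen : C.length = C'.length) (h : ∀ c ∈ C, c.2.length = d) (h' : ∀ c ∈ C', c.2.length = d)
    (e : combWords C = combWords C') : C = C' := by
  induction C generalizing C' with
  | nil => simpa [eq_comm] using hlen
  | cons c C ih =>
    cases C' with
    | nil => simp at hlen
    | cons c' C' =>
      obtain ⟨x, T⟩ := c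
      obtain ⟨x', T'⟩ := c'
      simp only [combWords, List.cons.injEq] at e
      obtain ⟨rfl, e⟩ := e
      have hT : T.length = T'.length :=
        (h _ List.mem_cons_self).trans (h' _ List.mem_cons_self).symm
      obtain ⟨e1, rfl⟩ := List.append_inj' e hT
      rw [ih (by simpa using hlen) (fun c hc => h c (List.mem_cons_of_mem _ hc))
        (fun c hc => h' c (List.mem_cons_of_mem _ hc)) e1]

theorem length_toothNodes {B : Type} (s : List B) (T : List (List B)) :
    (toothNodes s T).length = T.length := by
  induction T generalizing s with
  | nil => rfl
  | cons y T ih => simp [toothNodes, ih]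

theorem length_combNodes {B : Type} {C : List (List B × List (List B))} {d : ℕ} (s : List B)
    (h : ∀ c ∈ C, c.2.length = d) : (combNodes s C).length = C.length * d := by
  induction C generalizing s with
  | nil => simp [combNodes]
  | cons c C ih =>
    have h1 := ih (s ++ c.1) fun c' hc' => h c' (List.mem_cons_of_mem _ hc')
    have h2 := h c List.mem_cons_self
    simp only [combNodes, List.length_cons, List.length_append, h1, length_toothNodes, h2]
    ring

theorem toothNodes_append {B : Type} (s : List B) (T T' : List (List B)) :
    toothNodes s (T ++ T') = toothNodes s T ++ toothNodes (s ++ T.flatten) T' := by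
  induction T generalizing s with
  | nil => simp [toothNodes]
  | cons y T ih => simp [toothNodes, ih]

theorem prefix_of_mem_toothNodes {B : Type} {s η : List B} {T : List (List B)}
    (h : η ∈ toothNodes s T) : η <+: s ++ T.flatten := by
  induction T generalizing s with
  | nil => simp [toothNodes] at h
  | cons y T ih =>
    rcases List.mem_cons.1 h with rfl | h
    · simp
    · simpa using ih h

/-! ### Meets -/

theorem prefix_meet_iff {A : Type} [DecidableEq A] {p η ν : List A} :
    p <+: meet η ν ↔ p <+: η ∧ p <+: ν := by
  induction η generalizing p ν with
  | nil => simp +contextual [meet]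
  | cons a η ih =>
    cases ν with
    | nil => simp +contextual [meet]
    | cons b ν =>
      cases p with
      | nil => simp
      | cons c p =>
        by_cases hab : a = b
        · subst hab
          simp [meet, ih]; tauto
        · simp [meet, hab]
          rintro rfl _ rfl
          exact absurd rfl hab

theorem prefix_meetAll_iff {A : Type} [DecidableEq A] {p : List A} {s : List (List A)}
    (hs : s ≠ []) : p <+: meetAll s ↔ ∀ η ∈ s, p <+: η := by
  induction s with
  | nil => exact absurd rfl hs
  | cons η s ih =>
    cases s with
    | nil => simp [meetAll]
    | cons ν s => rw [meetAll, prefix_meet_iff, ih (by simp)]; simp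

/-! ### The ends of the teeth of a comb -/

/-- The end nodes of the teeth of a comb, from the top down. -/
def combTips {B : Type} (s : List B) : List (List B × List (List B)) → List (List B)
  | [] => []
  | (x, T) :: C => combTips (s ++ x) C ++ [s ++ x ++ T.flatten]

theorem length_combTips {B : Type} (s : List B) (C : List (List B × List (List B))) :
    (combTips s C).length = C.length := by
  induction C generalizing s with
  | nil => rfl
  | cons c C ih => simp [combTips, ih]

theorem combTips_subset_combNodes {B : Type} (s : List B) {C : List (List B × List (List B))}
    (h : ∀ c ∈ C, c.2 ≠ []) : combTips s C ⊆ combNodes s C := by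
  induction C generalizing s with
  | nil => simp [combTips]
  | cons c C ih =>
    obtain ⟨x, T⟩ := c
    have hT : T ≠ [] := h _ List.mem_cons_self
    have hmem : s ++ x ++ T.flatten ∈ toothNodes (s ++ x) T := by
      obtain rfl | ⟨T', y, rfl⟩ := List.eq_nil_or_concat' T
      · exact absurd rfl hT
      · simp [toothNodes_append, toothNodes]
    intro η hη
    rcases List.mem_append.1 hη with hη | hη
    · exact List.mem_append_left _ (ih _ (fun c hc => h c (List.mem_cons_of_mem _ hc)) hη)
    · rw [List.mem_singleton.1 hη]
      exact List.mem_append_right _ hmem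

theorem prefix_of_mem_combTips {B : Type} {s η x : List B} {T : List (List B)}
    {C : List (List B × List (List B))} (h : η ∈ combTips s ((x, T) :: C)) : s ++ x <+: η := by
  induction C generalizing s x T with
  | nil =>
    simp only [combTips, List.nil_append, List.mem_singleton] at h
    simp [h]
  | cons c C ih =>
    obtain ⟨y, T'⟩ := c
    rw [combTips] at h
    rcases List.mem_append.1 h with h | h
    · exact (List.prefix_append _ _).trans (ih h)
    · simp only [List.mem_singleton] at h
      simp [h]

/-- Both words are nonempty and the first letter of the first is smaller. -/
def HeadLT (u v : List ℕ) : Prop :=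
  ∃ a t b t', u = a :: t ∧ v = b :: t' ∧ a < b

/-- All of `s` passes through `q ++ u`, while `q ++ v` leaves it at the first letter after `q`.
Hence the meet gets strictly shorter, and the larger letter puts the new node last. -/
theorem isDescendingComb_append_singleton {s : List (List ℕ)} {q u v : List ℕ}
    (hs : IsDescendingComb s) (hq : ∀ η ∈ s, q ++ u <+: η) (huv : HeadLT u v) :
    IsDescendingComb (s ++ [q ++ v]) := by
  obtain ⟨a, t, b, t', rfl, rfl, hab⟩ := huv
  obtain ⟨h1, h2, h3⟩ := hs
  have hne : ∀ r : List ℕ, ¬ q ++ a :: t ++ r <+: q ++ b :: t' := by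
    intro r h
    rw [List.append_assoc, List.prefix_append_right_inj] at h
    simp only [List.cons_append, List.cons_prefix_cons] at h
    omega
  refine ⟨List.pairwise_append.2 ⟨h1, by simp, ?_⟩, List.pairwise_append.2 ⟨h2, by simp, ?_⟩, ?_⟩
  · intro η hη ν hν
    rw [List.mem_singleton.1 hν]
    obtain ⟨r, rfl⟩ := hq η hη
    refine ⟨hne r, fun h => ?_⟩
    rw [List.append_assoc, List.prefix_append_right_inj] at h
    simp only [List.cons_append, List.cons_prefix_cons] at h
    omega
  · intro η hη ν hν
    rw [List.mem_singleton.1 hν]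
    obtain ⟨r, rfl⟩ := hq η hη
    rw [List.append_assoc]
    exact List.append_left_lt (List.Lex.rel hab)
  · intro j hj hjs
    rw [List.length_append, List.length_singleton] at hjs
    rcases Nat.lt_or_ge j s.length with hlt | hge
    · rw [List.take_append_of_le_length hlt, List.take_append_of_le_length hlt.le]
      exact h3 j hj hlt
    · obtain rfl : j = s.length := by omega
      have hs0 : s ≠ [] := by rintro rfl; simp at hj
      rw [List.take_of_length_le (by simp), List.take_left']
      · refine ⟨(prefix_meetAll_iff hs0).2 fun η hη => ?_, fun e => ?_⟩
        · exact (prefix_meetAll_iff (by simp)).1 List.prefix_rfl η (by simp [hη])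
        · have hqs : q ++ a :: t <+: meetAll s := (prefix_meetAll_iff hs0).2 hq
          rw [← e] at hqs
          have := (prefix_meetAll_iff (by simp)).1 hqs (q ++ b :: t') (by simp)
          exact hne [] (by simpa using this)
      · rfl

/-- In `combWords` each tooth comes after all of the spine above it, so its first letter exceeds
that of the next spine word, through which all higher tips pass. The tips can thus be added one at a
time from the top down. -/
theorem isDescendingComb_combTips (s : List ℕ) {C : List (List ℕ × List (List ℕ))}
    (h : ∀ c ∈ C, c.2 ≠ []) (hw : (combWords C).Pairwise HeadLT) :
    IsDescendingComb (combTips s C) := by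
  induction C generalizing s with
  | nil => simp [combTips, IsDescendingComb]
  | cons c C ih =>
    obtain ⟨x, T⟩ := c
    rw [combWords, List.pairwise_cons, List.pairwise_append] at hw
    obtain ⟨-, hC, -, hCT⟩ := hw
    have ih' := ih (s ++ x) (fun c hc => h c (List.mem_cons_of_mem _ hc)) hC
    cases C with
    | nil =>
      simp only [combTips, IsDescendingComb, List.nil_append, List.pairwise_singleton,
        List.length_singleton, true_and]
      omega
    | cons c C =>
      obtain ⟨y, T'⟩ := c
      cases T with
      | nil => exact absurd rfl (h _ List.mem_cons_self)
      | cons z T =>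
        refine isDescendingComb_append_singleton ih'
          (fun η hη => prefix_of_mem_combTips hη) (v := (z :: T).flatten) ?_
        obtain ⟨a, t, b, t', rfl, rfl, hab⟩ := hCT y (by simp [combWords]) z (by simp)
        exact ⟨a, t, b, t' ++ T.flatten, rfl, by simp, hab⟩

/-! ### Binary trees of combs inside a long list of words -/

/-- In a long enough list one can find sublists `f ν`, `ν ∈ 2^{≤ E}`, consisting of one segment of
length `r` for each initial segment of `ν`, listed so that of two incomparable nodes one has its
segments wholly before those of the other, apart from those they share. -/
theorem exists_tree_of_sublists {A : Type} (r E : ℕ) :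
    ∃ M : ℕ, ∀ ws : List A, M ≤ ws.length → ∃ f : List Bool → List A,
      (∀ ν, ν.length ≤ E → (f ν).Sublist ws ∧ (f ν).length = r * (ν.length + 1)) ∧
      (∀ μ ν, μ <+: ν → ν.length ≤ E → f μ <+: f ν) ∧
      ∀ η ν, η.length ≤ E → ν.length ≤ E → Incomparable η ν →
        ∃ R S S' : List A, r ≤ R.length ∧ r ≤ S.length ∧ r ≤ S'.length ∧
          (R ++ S ++ S').Sublist ws ∧
          (f η = R ++ S ∧ f ν = R ++ S' ∨ f ν = R ++ S ∧ f η = R ++ S') := by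
  induction E with
  | zero =>
    refine ⟨r, fun ws hws => ⟨fun _ => ws.take r, fun ν hν => ⟨List.take_sublist _ _, ?_⟩,
      fun _ _ _ _ => List.prefix_rfl, fun η ν hη hν h => ?_⟩⟩
    · rw [Nat.le_zero.1 hν, List.length_take]
      omega
    · rw [List.length_eq_zero_iff.1 (Nat.le_zero.1 hη)] at h
      exact absurd List.nil_prefix h.1
  | succ E ih =>
    obtain ⟨M, hM⟩ := ih
    -- The first `r` entries are the root segment, shared by all nodes; the two subtrees use
    -- disjoint consecutive stretches.
    refine ⟨r + (M + M), fun ws hws => ?_⟩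
    obtain ⟨R₀, ws, rfl, hR₀⟩ : ∃ R₀ ws', ws = R₀ ++ ws' ∧ R₀.length = r :=
      ⟨_, _, (List.take_append_drop r ws).symm, by rw [List.length_take]; omega⟩
    rw [List.length_append] at hws
    obtain ⟨W, W', rfl, hW⟩ : ∃ W W', ws = W ++ W' ∧ W.length = M :=
      ⟨_, _, (List.take_append_drop M ws).symm, by rw [List.length_take]; omega⟩
    rw [List.length_append] at hws
    obtain ⟨f, hf1, hf2, hf3⟩ := hM W (by omega)
    obtain ⟨g, hg1, hg2, hg3⟩ := hM W' (by omega)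
    let F : List Bool → List A
      | [] => R₀
      | false :: ν => R₀ ++ f ν
      | true :: ν => R₀ ++ g ν
    have hsf : ∀ {X : List A}, X.Sublist W → (R₀ ++ X).Sublist (R₀ ++ (W ++ W')) := fun h =>
      (List.Sublist.refl R₀).append (h.trans (List.sublist_append_left _ _))
    have hsg : ∀ {X : List A}, X.Sublist W' → (R₀ ++ X).Sublist (R₀ ++ (W ++ W')) := fun h =>
      (List.Sublist.refl R₀).append (h.trans (List.sublist_append_right _ _))
    have hlen : ∀ {X : List A} {m : ℕ}, X.length = r * (m + 1) →
        (R₀ ++ X).length = r * (m + 1 + 1) := fun h => by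
      rw [List.length_append, h, hR₀]; ring
    refine ⟨F, ?_, ?_, ?_⟩
    · rintro (_ | ⟨_ | _, ν⟩) hν
      · exact ⟨List.sublist_append_left _ _, by simp [F, hR₀]⟩
      · have := hf1 ν (by simpa using hν)
        exact ⟨hsf this.1, hlen this.2⟩
      · have := hg1 ν (by simpa using hν)
        exact ⟨hsg this.1, hlen this.2⟩
    · rintro (_ | ⟨b, μ⟩) (_ | ⟨c, ν⟩) h hν
      · exact List.prefix_rfl
      · cases c <;> exact List.prefix_append _ _
      · simp at h
      · obtain ⟨rfl, h'⟩ := List.cons_prefix_cons.1 h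
        have hν' : ν.length ≤ E := by simpa using hν
        cases b
        · exact (List.prefix_append_right_inj _).2 (hf2 _ _ h' hν')
        · exact (List.prefix_append_right_inj _).2 (hg2 _ _ h' hν')
    · rintro (_ | ⟨b, η⟩) (_ | ⟨c, ν⟩) hη hν h
      · exact absurd List.nil_prefix h.1
      · exact absurd List.nil_prefix h.1
      · exact absurd List.nil_prefix h.2
      · have hη' : η.length ≤ E := by simpa using hη
        have hν' : ν.length ≤ E := by simpa using hν
        have hlong : ∀ {X : List A} {m : ℕ}, X.length = r * (m + 1) → r ≤ X.length := fun e => by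
          rw [e]; exact Nat.le_mul_of_pos_right _ (Nat.succ_pos _)
        by_cases hbc : b = c
        · subst hbc
          have h' : Incomparable η ν := by
            simpa [Incomparable] using h
          cases b
          · obtain ⟨R, S, S', h1, h2, h3, h4, h5⟩ := hf3 η ν hη' hν' h'
            refine ⟨R₀ ++ R, S, S', by simp; omega, h2, h3, by simpa using hsf h4, ?_⟩
            rcases h5 with h5 | h5
            · left; simp [F, h5]
            · right; simp [F, h5]
          · obtain ⟨R, S, S', h1, h2, h3, h4, h5⟩ := hg3 η ν hη' hν' h'
            refine ⟨R₀ ++ R, S, S', by simp; omega, h2, h3, by simpa using hsg h4, ?_⟩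
            rcases h5 with h5 | h5
            · left; simp [F, h5]
            · right; simp [F, h5]
        · have hs : ∀ α β : List Bool, α.length ≤ E → β.length ≤ E →
              (R₀ ++ f α ++ g β).Sublist (R₀ ++ (W ++ W')) := fun α β hα hβ => by
            rw [List.append_assoc]
            exact (List.Sublist.refl R₀).append ((hf1 α hα).1.append (hg1 β hβ).1)
          cases b <;> cases c
          · exact absurd rfl hbc
          · exact ⟨R₀, f η, g ν, hR₀.ge, hlong (hf1 η hη').2, hlong (hg1 ν hν').2, hs _ _ hη' hν',
              Or.inl ⟨rfl, rfl⟩⟩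
          · exact ⟨R₀, f ν, g η, hR₀.ge, hlong (hf1 ν hν').2, hlong (hg1 η hη').2, hs _ _ hν' hη',
              Or.inr ⟨rfl, rfl⟩⟩
          · exact absurd rfl hbc

/-- Cut a list into blocks, all of them singletons except for the first, which leaves `d`
entries to the others. -/
def tailBlocks {A : Type} (d : ℕ) (T : List A) : List (List A) :=
  T.take (T.length - d) :: (T.drop (T.length - d)).map fun a => [a]

theorem tailBlocks_append {A : Type} {d : ℕ} (T : List A) {T' : List A} (h : T'.length = d) :
    tailBlocks d (T ++ T') = T :: T'.map fun a => [a] := by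
  subst h
  simp [tailBlocks]

theorem flatten_tailBlocks {A : Type} (d : ℕ) (T : List A) : (tailBlocks d T).flatten = T := by
  have h : ∀ l : List A, (l.map fun a => [a]).flatten = l := fun l => by
    induction l <;> simp_all
  rw [tailBlocks, List.flatten_cons, h, List.take_append_drop]

theorem length_tailBlocks {A : Type} {d : ℕ} {T : List A} (h : d ≤ T.length) :
    (tailBlocks d T).length = d + 1 := by
  simp [tailBlocks]; omega

theorem nil_notMem_tailBlocks {A : Type} {d : ℕ} {T : List A} (h : d < T.length) :
    [] ∉ tailBlocks d T := by
  simp only [tailBlocks, List.mem_cons, not_or]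
  refine ⟨fun e => ?_, fun h => by
    rw [List.map_drop] at h
    simpa using List.mem_of_mem_drop h⟩
  have := congrArg List.length e
  simp only [List.length_nil, List.length_take] at this
  omega

theorem exists_eq_append_length {A : Type} {d : ℕ} {T : List A} (h : d ≤ T.length) :
    ∃ T₁ T₂, T = T₁ ++ T₂ ∧ T₂.length = d :=
  ⟨_, _, (List.take_append_drop (T.length - d) T).symm, by simp; omega⟩

/-- Merge the entries of a tooth so that only its last `d + 1` nodes remain. -/
def trimTooth {B : Type} (d : ℕ) (T : List (List B)) : List (List B) :=
  (tailBlocks d T).map List.flatten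

theorem trimTooth_append {B : Type} {d : ℕ} (T : List (List B)) {T' : List (List B)}
    (h : T'.length = d) : trimTooth d (T ++ T') = T.flatten :: T' := by
  simp [trimTooth, tailBlocks_append T h, Function.comp_def]

/-- Merging words only deletes nodes. The inequality is strict because an empty first block would
produce the base point `s`, which need not be on the tooth. -/
theorem toothNodes_trimTooth_subset {B : Type} {d : ℕ} {T : List (List B)} (s : List B)
    (h : d < T.length) : toothNodes s (trimTooth d T) ⊆ toothNodes s T := by
  obtain ⟨T₁, T₂, rfl, h₂⟩ := exists_eq_append_length h.le
  rw [trimTooth_append T₁ h₂, toothNodes_append, toothNodes]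
  obtain rfl | ⟨T', y, rfl⟩ := List.eq_nil_or_concat' T₁
  · simp [h₂] at h
  · simp [toothNodes_append, toothNodes]

/-- Moving an initial piece `R` of a tooth into the spine keeps its last `d + 1` nodes. So two teeth
that share `R` can be reread as two teeth on a longer spine. -/
theorem toothNodes_trimTooth_append {B : Type} {d : ℕ} (s : List B) (R : List (List B))
    {T : List (List B)} (h : d ≤ T.length) :
    toothNodes (s ++ R.flatten) (trimTooth d T) = toothNodes s (trimTooth d (R ++ T)) := by
  obtain ⟨T₁, T₂, rfl, h₂⟩ := exists_eq_append_length h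
  rw [trimTooth_append T₁ h₂, ← List.append_assoc, trimTooth_append _ h₂]
  simp [toothNodes]

/-- Trim all teeth of a comb. -/
def trim {B : Type} (d : ℕ) (C : List (List B × List (List B))) : List (List B × List (List B)) :=
  C.map (Prod.map id (trimTooth d))

/-- In a long enough list of words one can find combs with `n + 1` teeth, indexed by `2^{≤ E}` and
growing along its branches, such that the trimmed combs at two incomparable nodes together contain a
comb with `n + 2` teeth. -/
theorem exists_tree_of_combs {B : Type} (d E n : ℕ) :
    ∃ M : ℕ, ∀ l : List (List B), M ≤ l.length →
      ∃ C : List Bool → List (List B × List (List B)),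
        (∀ ν, ν.length ≤ E → (combWords (C ν)).Sublist l ∧ (C ν).length = n + 1 ∧
          ∀ c ∈ C ν, c.2.length = (d + 2) * (ν.length + 1)) ∧
        (∀ μ ν, μ <+: ν → ν.length ≤ E → ∀ s,
          combNodes s (trim d (C μ)) ⊆ combNodes s (C ν)) ∧
        ∀ η ν, η.length ≤ E → ν.length ≤ E → Incomparable η ν →
          ∃ D : List (List (List B) × List (List (List B))),
            D.length = n + 2 ∧ (∀ c ∈ D, c.2.length = d + 1) ∧ [] ∉ combWords D ∧
            (combWords D).flatten.Sublist l ∧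
            ∀ s, combNodes s (combMap List.flatten D) ⊆
              combNodes s (trim d (C η)) ++ combNodes s (trim d (C ν)) := by
  obtain ⟨M₀, hM₀⟩ := exists_tree_of_sublists (A := List B) (d + 2) E
  have hlong : ∀ {X : List (List B)} {m : ℕ}, X.length = (d + 2) * (m + 1) → d < X.length :=
    fun e => by rw [e]; nlinarith
  have hmono : ∀ {f : List Bool → List (List B)} {μ ν : List Bool} (s : List B), f μ <+: f ν →
      d < (f μ).length → toothNodes s (trimTooth d (f μ)) ⊆ toothNodes s (f ν) := by
    rintro f μ ν s ⟨R, hR⟩ h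
    rw [← hR, toothNodes_append]
    exact List.Subset.trans (toothNodes_trimTooth_subset s h) (List.subset_append_left _ _)
  induction n with
  | zero =>
    refine ⟨M₀ + 1, fun l hl => ?_⟩
    cases l with
    | nil => simp at hl
    | cons x ws =>
      obtain ⟨f, hf1, hf2, hf3⟩ := hM₀ ws (by simpa using hl)
      refine ⟨fun ν => [(x, f ν)], fun ν hν => ⟨?_, rfl, ?_⟩, fun μ ν h hν s => ?_,
        fun η ν hη hν h => ?_⟩
      · simpa [combWords] using (hf1 ν hν).1
      · simpa using (hf1 ν hν).2
      · simpa [combNodes, trim] using hmono (s ++ x) (hf2 μ ν h hν)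
          (hlong (hf1 μ (h.length_le.trans hν)).2)
      · have key : ∀ R S S' : List (List B), d + 2 ≤ R.length → d + 2 ≤ S.length →
            d + 2 ≤ S'.length → (R ++ S ++ S').Sublist ws →
            ∃ D : List (List (List B) × List (List (List B))),
              D.length = 2 ∧ (∀ c ∈ D, c.2.length = d + 1) ∧ [] ∉ combWords D ∧
              (combWords D).flatten.Sublist (x :: ws) ∧
              ∀ s, combNodes s (combMap List.flatten D) ⊆
                combNodes s (trim d [(x, R ++ S)]) ++ combNodes s (trim d [(x, R ++ S')]) := by
          intro R S S' hR hS hS' hsub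
          cases S with
          | nil => simp at hS
          | cons y S =>
            rw [List.length_cons] at hS
            -- The spine runs through the common part `x R` and then takes the first word `y` of the
            -- earlier continuation; the later one is the lower tooth. Segments have length `d + 2`
            -- so that `d + 1` words remain after `y`.
            refine ⟨[(x :: R, tailBlocks d S'), ([y], tailBlocks d S)], rfl, ?_, ?_, ?_, ?_⟩
            · simp [length_tailBlocks (show d ≤ S.length by omega),
                length_tailBlocks (show d ≤ S'.length by omega)]
            · simp [combWords, nil_notMem_tailBlocks (show d < S.length by omega),
                nil_notMem_tailBlocks (show d < S'.length by omega)]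
            · simpa [combWords, flatten_tailBlocks] using hsub
            · intro s
              have e1 := toothNodes_trimTooth_append (s ++ x) (R ++ [y])
                (show d ≤ S.length by omega)
              have e2 := toothNodes_trimTooth_append (s ++ x) R (show d ≤ S'.length by omega)
              simp only [List.append_assoc, List.flatten_append, List.flatten_cons,
                List.flatten_nil, List.append_nil, List.singleton_append, trimTooth] at e1 e2
              simp [combNodes, combMap, trim, trimTooth, e1, e2]
        obtain ⟨R, S, S', h1, h2, h3, h4, h5⟩ := hf3 η ν hη hν h
        obtain ⟨D, hD1, hD2, hD3, hD4, hD5⟩ := key R S S' h1 h2 h3 h4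
        refine ⟨D, hD1, hD2, hD3, hD4, fun s => ?_⟩
        rcases h5 with ⟨e1, e2⟩ | ⟨e1, e2⟩
        · simpa only [e1, e2] using hD5 s
        · simp only [e1, e2]
          exact List.Subset.trans (hD5 s) List.perm_append_comm.subset
  | succ n ih =>
    obtain ⟨M, hM⟩ := ih
    refine ⟨M + M₀ + 1, fun l hl => ?_⟩
    cases l with
    | nil => simp at hl
    | cons x ws =>
      rw [List.length_cons] at hl
      obtain ⟨W, W', rfl, hW⟩ : ∃ W W', ws = W ++ W' ∧ W.length = M :=
        ⟨_, _, (List.take_append_drop M ws).symm, by rw [List.length_take]; omega⟩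
      rw [List.length_append] at hl
      obtain ⟨f, hf1, hf2, -⟩ := hM₀ W' (by omega)
      obtain ⟨C, hC1, hC2, hC3⟩ := hM W (by omega)
      refine ⟨fun ν => (x, f ν) :: C ν, fun ν hν => ⟨?_, ?_, ?_⟩, fun μ ν h hν s => ?_,
        fun η ν hη hν h => ?_⟩
      · exact ((hC1 ν hν).1.append (hf1 ν hν).1).cons_cons x
      · simp [(hC1 ν hν).2.1]
      · exact List.forall_mem_cons.2 ⟨(hf1 ν hν).2, (hC1 ν hν).2.2⟩
      · have h1 := hC2 μ ν h hν (s ++ x)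
        have h2 := hmono (s ++ x) (hf2 μ ν h hν) (hlong (hf1 μ (h.length_le.trans hν)).2)
        exact List.append_subset.2 ⟨List.Subset.trans h1 (List.subset_append_left _ _),
          List.Subset.trans h2 (List.subset_append_right _ _)⟩
      · obtain ⟨D, hD1, hD2, hD3, hD4, hD5⟩ := hC3 η ν hη hν h
        have hfη := hlong (hf1 η hη).2
        -- Only the top tooth has to fork; for the lower ones those of `η` suffice.
        refine ⟨([x], tailBlocks d (f η)) :: D, by simp [hD1],
          List.forall_mem_cons.2 ⟨length_tailBlocks hfη.le, hD2⟩, ?_, ?_, fun s => ?_⟩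
        · simp [combWords, hD3, nil_notMem_tailBlocks hfη]
        · simpa [combWords, flatten_tailBlocks] using hD4.append (hf1 η hη).1
        · intro w hw
          have := @hD5 (s ++ x) w
          simp only [combMap, List.map_cons, Prod.map, combNodes, List.flatten_cons,
            List.flatten_nil, List.append_nil, List.mem_append, trim, id, trimTooth] at hw this ⊢
          tauto

/-! ### From missing descending combs to finite binary trees -/

/-- The list of words can be read as a comb with `n` teeth of length `d + 1` whose nodes
satisfy `K`. -/
def IsCombWith {B : Type} (K : List (List B) → Prop) (n d : ℕ) (ws : List (List B)) : Prop :=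
  ∃ C, combWords C = ws ∧ C.length = n ∧ (∀ c ∈ C, c.2.length = d + 1) ∧ K (combNodes [] C)

/-- A list of words has only one reading as a comb of the given dimensions, so the negation of
`IsCombWith` refutes `K` for a given comb. -/
theorem isCombWith_combWords {B : Type} {K : List (List B) → Prop} {n d : ℕ}
    {C : List (List B × List (List B))} (hn : C.length = n) (hd : ∀ c ∈ C, c.2.length = d + 1) :
    IsCombWith K n d (combWords C) ↔ K (combNodes [] C) := by
  refine ⟨?_, fun h => ⟨C, rfl, hn, hd, h⟩⟩
  rintro ⟨C', e, hn', hd', h⟩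
  rwa [← combWords_injective (hn'.trans hn.symm) hd' hd e]

/-- If a hereditary family of finite sets of nodes of `ω^{<ω}` contains all finite chains but no
descending comb of length `k`, then for some `N` there are arbitrarily high binary trees of sets of
`N` nodes whose unions along branches belong to the family, while the union of the sets at two
incomparable nodes never does. -/
theorem exists_trees_of_no_descendingComb {K : List (List ℕ) → Prop} {k : ℕ} (hk : 2 ≤ k)
    (hmono : ∀ S S', S ⊆ S' → K S' → K S)
    (hchain : ∀ (S : List (List ℕ)) (η : List ℕ), (∀ ν ∈ S, ν <+: η) → K S)
    (hcomb : ∀ s : List (List ℕ), s.length = k → IsDescendingComb s → ¬ K s) :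
    ∃ N : ℕ, ∀ E : ℕ, ∃ c : List Bool → List (List ℕ),
      (∀ ν, ν.length ≤ E → (c ν).length = N) ∧
      (∀ ν, ν.length = E → ∃ S, K S ∧ ∀ μ, μ <+: ν → c μ ⊆ S) ∧
      ∀ η ν, η.length ≤ E → ν.length ≤ E → Incomparable η ν → ¬ K (c η ++ c ν) := by
  obtain ⟨p, hp, hhead⟩ := exists_idempotent_ultrafilter_words
  -- Each tooth costs one spine word and `d + 1` words of its own.
  let P : ℕ → ℕ → Prop := fun n d => Generically p (n * (d + 2)) (IsCombWith K n d)
  have hP1 : ∀ d, P 1 d := fun d => Generically.of_forall fun ws hws => by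
    cases ws with
    | nil => simp at hws
    | cons x T =>
      have hT : T.length = d + 1 := by simpa using hws
      exact ⟨[(x, T)], by simp [combWords], rfl, by simpa using hT,
        hchain _ (x ++ T.flatten) fun ν hν => prefix_of_mem_toothNodes (by simpa [combNodes] using hν)⟩
  have hheads : Generically p 2 fun ws => ∀ u v, ws = [u, v] → HeadLT u v :=
    (hhead 0).mono fun u hu => by
      obtain ⟨a, t, rfl, -⟩ := hu
      refine (hhead a).mono fun v hv u' v' e => ?_
      obtain ⟨b, t', rfl, hab⟩ := hv
      simp only [List.cons.injEq, and_true] at e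
      obtain ⟨rfl, rfl⟩ := e
      exact ⟨a, t, b, t', rfl, rfl, hab⟩
  have hPk : ¬ P k 0 := fun h => by
    obtain ⟨ws, hws, hQ, hh⟩ :=
      ((h.blocks hp (k * 2)).and (hheads.blocks hp (k * 2))).exists_list
    have hid : ∀ l : List (List ℕ), (l.map fun w => [w]).flatten = l := fun l => by
      induction l <;> simp_all
    have hmap : ∀ l : List (List ℕ), (l.map fun w => [w]).map List.flatten = l := fun l => by
      simp [Function.comp_def]
    have hQ' := hQ (ws.map fun w => [w]) (by rw [hid]) (by simp) (by simp [hws])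
    rw [hmap] at hQ'
    obtain ⟨C, hC, hCk, hC1, hKC⟩ := hQ'
    have hne : ∀ c ∈ C, c.2 ≠ [] := fun c hc e => by simpa [e] using hC1 c hc
    have hpair : (combWords C).Pairwise HeadLT := by
      rw [hC, List.pairwise_iff_forall_sublist]
      intro u v huv
      exact hh [[u], [v]] (by simpa using huv) (by simp) rfl u v (by simp)
    exact hcomb (combTips [] C) (by rw [length_combTips, hCk])
      (isDescendingComb_combTips [] hne hpair) (hmono _ _ (combTips_subset_combNodes [] hne) hKC)
  -- Otherwise `∀ d, P (n + 1) d` would propagate from one tooth to `k` teeth, against `hPk`.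
  obtain ⟨n, hn, d, hnd⟩ : ∃ n, (∀ d, P (n + 1) d) ∧ ∃ d, ¬ P (n + 2) d := by
    by_contra! hcon
    have hall : ∀ n d, P (n + 1) d := fun n => by
      induction n with
      | zero => exact hP1
      | succ n ih => exact hcon n ih
    obtain ⟨j, rfl⟩ : ∃ j, k = j + 1 := ⟨k - 1, by omega⟩
    exact hPk (hall j 0)
  refine ⟨(n + 1) * (d + 1), fun E => ?_⟩
  obtain ⟨M, hM⟩ := exists_tree_of_combs (B := ℕ) d E n
  -- The teeth at height `E` have `e + 1` words, so `P (n + 1) e` governs the leaf combs.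
  obtain ⟨e, he⟩ : ∃ e, (d + 2) * (E + 1) = e + 1 :=
    ⟨(d + 2) * (E + 1) - 1, (Nat.sub_add_cancel (Nat.mul_pos (by omega) (by omega))).symm⟩
  obtain ⟨l, hl, hyes, hno⟩ := (((hn e).blocks hp M).and ((Generically.not hnd).blocks hp M)).exists_list
  obtain ⟨C, hC1, hC2, hC3⟩ := hM l hl.ge
  refine ⟨fun ν => combNodes [] (trim d (C ν)), fun ν hν => ?_, fun ν hν => ?_,
    fun η ν hη hν h hKu => ?_⟩
  · obtain ⟨-, hlen, hteeth⟩ := hC1 ν hν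
    rw [length_combNodes (d := d + 1), trim, List.length_map, hlen]
    intro c hc
    obtain ⟨c', hc', rfl⟩ := List.mem_map.1 hc
    have := hteeth c' hc'
    simp only [Prod.map, trimTooth, List.length_map]
    exact length_tailBlocks (by rw [this]; nlinarith)
  · obtain ⟨hsub, hlen, hteeth⟩ := hC1 ν hν.le
    rw [hν, he] at hteeth
    refine ⟨combNodes [] (C ν), ?_, fun μ h => hC2 μ ν h hν.le []⟩
    rw [← isCombWith_combWords (K := K) hlen hteeth]
    have hid : ((combWords (C ν)).map fun w => [w]).flatten = combWords (C ν) := by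
      induction combWords (C ν) <;> simp_all
    have := hyes ((combWords (C ν)).map fun w => [w]) (by rwa [hid]) (by simp)
      (by rw [List.length_map, length_combWords hteeth, hlen])
    simpa [Function.comp_def] using this
  · obtain ⟨D, hD1, hD2, hD3, hD4, hD5⟩ := hC3 η ν hη hν h
    have hw := hno (combWords D) hD4 hD3 (by rw [length_combWords hD2, hD1])
    rw [← combWords_combMap, isCombWith_combWords (by simpa [combMap] using hD1)] at hw
    · exact hw (hmono _ _ (hD5 []) hKu)
    · intro c hc
      obtain ⟨c', hc', rfl⟩ := List.mem_map.1 hc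
      simpa using hD2 c' hc'

/-! ### Branches, and a prefix code for `ω^{<ω}` in `2^{<ω}` -/

theorem restrict_prefix {A : Type} (σ : ℕ → A) {i j : ℕ} (h : i ≤ j) :
    restrict σ i <+: restrict σ j := by
  obtain ⟨r, rfl⟩ := Nat.exists_eq_add_of_le h
  rw [restrict, restrict, List.range_add, List.map_append]
  exact List.prefix_append _ _

theorem length_restrict {A : Type} (σ : ℕ → A) (i : ℕ) : (restrict σ i).length = i := by
  simp [restrict]

theorem getElem_restrict {A : Type} (σ : ℕ → A) {i j : ℕ} (h : j < (restrict σ i).length) :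
    (restrict σ i)[j] = σ j := by
  simp [restrict]

theorem restrict_getD_of_prefix {A : Type} {η ν : List A} (a : A) (h : ν <+: η) :
    restrict (fun i => η.getD i a) ν.length = ν := by
  refine List.ext_getElem (length_restrict _ _) fun i h1 h2 => ?_
  have h3 : i < η.length := h2.trans_le h.length_le
  simp [restrict, h3, h.getElem h2]

/-- The embedding of `ω^{<ω}` into `2^{<ω}` that sends the letter `a` to `1^a 0`. -/
def unaryCode (η : List ℕ) : List Bool :=
  (η.map fun a => List.replicate a true ++ [false]).flatten

theorem unaryCode_append (η ν : List ℕ) : unaryCode (η ++ ν) = unaryCode η ++ unaryCode ν := by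
  simp [unaryCode]

theorem length_le_length_unaryCode (η : List ℕ) : η.length ≤ (unaryCode η).length := by
  induction η with
  | nil => simp
  | cons a η ih =>
    simp only [unaryCode, List.map_cons, List.flatten_cons, List.length_append,
      List.length_cons, List.length_replicate, List.length_nil] at ih ⊢
    omega

theorem replicate_append_false_prefix {a b : ℕ} {s t : List Bool}
    (h : List.replicate a true ++ false :: s <+: List.replicate b true ++ false :: t) :
    a = b ∧ s <+: t := by
  induction a generalizing b with
  | zero =>
    cases b with
    | zero => simpa using h
    | succ b => simp [List.replicate_succ] at h
  | succ a ih =>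
    cases b with
    | zero => simp [List.replicate_succ] at h
    | succ b =>
      have := ih (b := b) (by simpa [List.replicate_succ] using h)
      exact ⟨congrArg (· + 1) this.1, this.2⟩

theorem prefix_of_unaryCode_prefix {η ν : List ℕ} (h : unaryCode η <+: unaryCode ν) : η <+: ν := by
  induction η generalizing ν with
  | nil => exact List.nil_prefix
  | cons a η ih =>
    cases ν with
    | nil => simp [unaryCode] at h
    | cons b ν =>
      have h' := replicate_append_false_prefix (s := unaryCode η) (t := unaryCode ν)
        (by simpa [unaryCode] using h)
      rw [h'.1]
      exact (List.prefix_cons_inj b).2 (ih h'.2)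

/-- The codes of the `σ ↾ i` extend one another. Each letter has a nonempty code, so the code of `σ
↾ (j + 1)` already decides bit `j`, and the default `false` is never read. -/
theorem exists_branch_unaryCode (σ : ℕ → ℕ) :
    ∃ τ : ℕ → Bool, ∀ i, unaryCode (restrict σ i) =
      restrict τ (unaryCode (restrict σ i)).length := by
  refine ⟨fun j => (unaryCode (restrict σ (j + 1))).getD j false, fun i => ?_⟩
  refine List.ext_getElem (length_restrict _ _).symm fun j h1 h2 => ?_
  have hj : j < (unaryCode (restrict σ (j + 1))).length :=
    (length_restrict σ (j + 1)).ge.trans (length_le_length_unaryCode _)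
  have hpre : ∀ {i i' : ℕ}, i ≤ i' → unaryCode (restrict σ i) <+: unaryCode (restrict σ i') := by
    intro i i' h
    obtain ⟨r, hr⟩ := restrict_prefix σ h
    rw [← hr, unaryCode_append]
    exact List.prefix_append _ _
  rw [getElem_restrict, List.getD_eq_getElem _ _ hj]
  rcases le_total i (j + 1) with h | h
  · exact (hpre h).getElem h1
  · exact ((hpre h).getElem hj).symm

end TreeIndex

/-! ### Transfer to formulas and models -/

namespace FirstOrder.Language

open Filter

theorem ConsistentInstances.mono {L : Language.{u, v}} {M : Type w} [L.Structure M] {m n : ℕ}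
    {φ : L.Formula (Fin m ⊕ Fin n)} {S S' : Set (Fin n → M)} (h : S ⊆ S')
    (hS : ConsistentInstances φ S') : ConsistentInstances φ S :=
  fun F hF => hS F (hF.trans h)

/-- The conjunction of `N` copies of `φ(x, y)` with disjoint parameter variables. -/
noncomputable def conjInstances {L : Language.{u, v}} {m n : ℕ} (φ : L.Formula (Fin m ⊕ Fin n))
    (N : ℕ) : L.Formula (Fin m ⊕ Fin (N * n)) :=
  Formula.iInf fun j : Fin N => φ.relabel (Sum.map id fun i => finProdFinEquiv (j, i))

theorem realize_conjInstances {L : Language.{u, v}} {M : Type w} [L.Structure M] {m n N : ℕ}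
    (φ : L.Formula (Fin m ⊕ Fin n)) (a : Fin m → M) (b : Fin N → Fin n → M) :
    (conjInstances φ N).Realize
        (Sum.elim a fun i => b (finProdFinEquiv.symm i).1 (finProdFinEquiv.symm i).2) ↔
      ∀ j, φ.Realize (Sum.elim a (b j)) := by
  simp only [conjInstances, Formula.realize_iInf, Formula.realize_relabel]
  refine forall_congr' fun j => iff_of_eq (congrArg _ ?_)
  ext i
  rcases i with i | i
  · rfl
  · exact congrArg (fun q : Fin N × Fin n => b q.1 q.2)
      (_root_.Equiv.symm_apply_apply finProdFinEquiv (j, i))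

/-- Finite trees of arbitrary height witnessing `SOP₂` for one formula in one model yield `SOP₂`. -/
theorem Theory.hasSOP2_of_finite_trees {L : Language.{u, v}} {T : L.Theory}
    (M : Theory.ModelType.{u, v, max u v} T) {m n : ℕ} (φ : L.Formula (Fin m ⊕ Fin n))
    (b : ℕ → List Bool → Fin n → M)
    (hpath : ∀ (E : ℕ) (ν : List Bool), ν.length = E →
      ∃ a : Fin m → M, ∀ μ, μ <+: ν → φ.Realize (Sum.elim a (b E μ)))
    (hinc : ∀ (E : ℕ) (η ν : List Bool), η.length ≤ E → ν.length ≤ E →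
      TreeIndex.Incomparable η ν →
        ¬ ∃ a : Fin m → M, φ.Realize (Sum.elim a (b E η)) ∧ φ.Realize (Sum.elim a (b E ν))) :
    T.HasSOP2 := by
  -- A nonprincipal ultrapower plays the role of compactness: coordinate `E` carries the tree of
  -- height `E`, and each fixed node is within height for almost all `E`.
  let U : Ultrafilter ℕ := hyperfilter ℕ
  let M' := (U : Filter ℕ).Product fun _ => (M : Type (max u v))
  have hmodel : M' ⊨ T := Theory.model_iff _ |>.2 fun ψ hψ =>
    (Ultraproduct.sentence_realize ψ).2
      (Eventually.of_forall fun _ => Theory.realize_sentence_of_mem T hψ)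
  have hlos : ∀ (a : Fin m → ℕ → M) (c : Fin n → ℕ → M),
      φ.Realize (Sum.elim (fun i => ((a i : ∀ _ : ℕ, M) : M')) fun i => ((c i : ∀ _ : ℕ, M) : M')) ↔
        ∀ᶠ E in (U : Filter ℕ), φ.Realize (Sum.elim (fun i => a i E) fun i => c i E) := by
    intro a c
    have e := Ultraproduct.realize_formula_cast (u := U) φ (Sum.elim a c)
    convert e using 2
    · ext i; cases i <;> rfl
    · funext E
      refine congrArg _ ?_
      ext i; cases i <;> rfl
  have hlarge : ∀ N : ℕ, ∀ᶠ E in (U : Filter ℕ), N ≤ E := fun N =>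
    Nat.hyperfilter_le_atTop (eventually_ge_atTop N)
  refine ⟨Theory.ModelType.of T M', m, n, φ,
    fun ν i => ((fun E => b E ν i : ∀ _ : ℕ, M) : M'), fun σ F hF _ => ?_, fun η ν h hcon => ?_⟩
  -- One tuple realizes the whole branch: the class of the realizations along `σ ↾ E`.
  · choose a ha using fun E => hpath E (TreeIndex.restrict σ E) (TreeIndex.length_restrict σ E)
    refine ⟨fun i => ((fun E => a E i : ∀ _ : ℕ, M) : M'), fun c hc => ?_⟩
    obtain ⟨i, rfl⟩ := hF hc
    exact (hlos _ _).2 ((hlarge i).mono fun E hE => ha E _ (TreeIndex.restrict_prefix σ hE))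
  · obtain ⟨a, ha⟩ := hcon _ subset_rfl ((Set.finite_singleton _).insert _)
    choose a' ha' using fun i => Quotient.exists_rep (a i)
    obtain rfl : (fun i => ((a' i : ∀ _ : ℕ, M) : M')) = a := funext ha'
    have h1 := (hlos a' _).1 (ha _ (Or.inl rfl))
    have h2 := (hlos a' _).1 (ha _ (Or.inr rfl))
    obtain ⟨E, h1, h2, h3, h4⟩ :=
      (h1.and (h2.and ((hlarge η.length).and (hlarge ν.length)))).exists
    exact hinc E η ν h3 h4 h ⟨_, h1, h2⟩

theorem Theory.HasSOP2.hasDCTP1 {L : Language.{u, v}} {T : L.Theory} (h : T.HasSOP2) {k : ℕ}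
    (hk : 2 ≤ k) : T.HasDCTP1 k := by
  obtain ⟨M, m, n, φ, b, hpath, hinc⟩ := h
  refine ⟨M, m, n, φ, fun η => b (TreeIndex.unaryCode η), fun σ => ?_, fun s hs hcomb hcon => ?_⟩
  · obtain ⟨τ, hτ⟩ := TreeIndex.exists_branch_unaryCode σ
    refine (hpath τ).mono ?_
    rintro _ ⟨i, rfl⟩
    exact ⟨_, congrArg b (hτ i).symm⟩
  · match s, hs with
    | [], hs => simp at hs; omega
    | [_], hs => simp at hs; omega
    | η :: ν :: s, _ =>
      have hην : TreeIndex.Incomparable η ν := (List.pairwise_cons.1 hcomb.1).1 ν (by simp)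
      refine hinc (TreeIndex.unaryCode η) (TreeIndex.unaryCode ν)
        ⟨fun h => hην.1 (TreeIndex.prefix_of_unaryCode_prefix h),
          fun h => hην.2 (TreeIndex.prefix_of_unaryCode_prefix h)⟩ (hcon.mono ?_)
      rintro c (rfl | rfl)
      · exact ⟨η, by simp, rfl⟩
      · exact ⟨ν, by simp, rfl⟩

/-- The combinatorial theorem is applied with `K` as joint satisfiability in `M`; the `N` parameters
at a tree node become one parameter tuple for `conjInstances φ N`. -/
theorem Theory.HasDCTP1.hasSOP2 {L : Language.{u, v}} {T : L.Theory} {k : ℕ} (hk : 2 ≤ k)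
    (h : T.HasDCTP1 k) : T.HasSOP2 := by
  obtain ⟨M, m, n, φ, b, hpath, hcomb⟩ := h
  let K : List (List ℕ) → Prop := fun S => ∃ a : Fin m → M, ∀ η ∈ S, φ.Realize (Sum.elim a (b η))
  obtain ⟨N, hN⟩ := TreeIndex.exists_trees_of_no_descendingComb (K := K) hk
    (fun S S' hSS' ⟨a, ha⟩ => ⟨a, fun η hη => ha η (hSS' hη)⟩)
    (fun S η hS => by
      -- A chain below `η` lies on the branch `η ⌢ 000…`.
      obtain ⟨a, ha⟩ := hpath (fun i => η.getD i 0) (b '' {ν | ν ∈ S})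
        (by
          rintro _ ⟨ν, hν, rfl⟩
          exact ⟨ν.length, congrArg b (TreeIndex.restrict_getD_of_prefix 0 (hS ν hν))⟩)
        ((List.finite_toSet S).image b)
      exact ⟨a, fun ν hν => ha _ ⟨ν, hν, rfl⟩⟩)
    (fun s hs hc ⟨a, ha⟩ => hcomb s hs hc fun F hF _ => ⟨a, fun c hcF => by
      obtain ⟨η, hη, rfl⟩ := hF hcF
      exact ha η hη⟩)
  choose c hlen hbranch hinc using hN
  have hmem : ∀ E ν, ν.length ≤ E → ∀ a : Fin m → M,
      (∀ j : Fin N, φ.Realize (Sum.elim a (b ((c E ν).getD j [])))) ↔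
        ∀ η ∈ c E ν, φ.Realize (Sum.elim a (b η)) := by
    intro E ν hν a
    have hl := hlen E ν hν
    refine ⟨fun h η hη => ?_, fun h j => h _ ?_⟩
    · obtain ⟨j, hj, rfl⟩ := List.getElem_of_mem hη
      simpa [hj] using h ⟨j, hl ▸ hj⟩
    · have hj : (j : ℕ) < (c E ν).length := hl ▸ j.2
      rw [List.getD_eq_getElem _ _ hj]
      exact List.getElem_mem hj
  refine Theory.hasSOP2_of_finite_trees M (conjInstances φ N)
    (fun E ν i => b ((c E ν).getD (finProdFinEquiv.symm i).1 []) (finProdFinEquiv.symm i).2)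
    (fun E ν hν => ?_) (fun E η ν hη hν h => ?_)
  · obtain ⟨S, ⟨a, ha⟩, hS⟩ := hbranch E ν hν
    refine ⟨a, fun μ hμ => ?_⟩
    rw [realize_conjInstances φ a fun j : Fin N => b ((c E μ).getD j []),
      hmem E μ (hν ▸ hμ.length_le)]
    exact fun η hη => ha η (hS μ hμ hη)
  · rintro ⟨a, h1, h2⟩
    rw [realize_conjInstances φ a fun j : Fin N => b ((c E _).getD j []), hmem E _ hη] at h1
    rw [realize_conjInstances φ a fun j : Fin N => b ((c E _).getD j []), hmem E _ hν] at h2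
    exact hinc E η ν hη hν h ⟨a, fun ξ hξ => (List.mem_append.1 hξ).elim (h1 ξ) (h2 ξ)⟩

end FirstOrder.Language

theorem lemma2p8 {L : FirstOrder.Language.{u, v}} (T : L.Theory) (k : ℕ) (hk : 2 ≤ k) :
    T.HasSOP2 ↔ T.HasDCTP1 k :=
  ⟨fun h => h.hasDCTP1 hk, fun h => h.hasSOP2 hk⟩
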